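/- Call a function $m\colon\mathfrak P(X)\to[0,1]$ on the subsets of a set $X$ a \emph{mean} if $m(X)=1$ and $m(A\sqcup B)=m(A)+m(B)$ for all disjoint $A,B\subseteq X$. A group $G$ is \emph{amenable} if on every non-empty right $G$-set $X$ there is a mean $m$ with $m(Ag)=m(A)$ for all $g\in G$ and all $A\subseteq X$. An \emph{interval exchange} is a permutation $g$ of the circle $\mathbb R/\mathbb Z$ that is right-continuous, has only finitely many points of discontinuity, and for which the set of angles $\sphericalangle(g)=\{g(x)-x\mid x\in\mathbb R/\mathbb Z\}$ is finite. The interval exchanges form a group $\mathrm{IET}$ under composition. \textbf{Theorem.} Let $\Lambda\le\mathbb R/\mathbb Z$ be a finitely generated subgroup of free rank at most $2$, that is, $\dim_{\mathbb Q}(\Lambda\otimes_{\mathbb Z}\mathbb Q)\le 2$. Then $$\mathrm{IET}(\Lambda)=\{g\in\mathrm{IET}\mid\sphericalangle(g)\subseteq\Lambda\}$$ is an amenable subgroup of $\mathrm{IET}$. -/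

import Mathlib

open Set Filter Topology
open scoped TensorProduct

universe v u

/-- A mean on a set `X`: a finitely additive function from the subsets of `X` to `[0, 1]`
giving mass `1` to `X`. -/
structure IsMean {X : Type*} (m : Set X → ℝ) : Prop where
  nonneg : ∀ A, 0 ≤ m A
  le_one : ∀ A, m A ≤ 1
  map_univ : m univ = 1
  map_union : ∀ A B, Disjoint A B → m (A ∪ B) = m A + m B

/-- A right `G`-set `X` (an action of the opposite group `Gᵐᵒᵖ`) is amenable if it carries
a mean `m` such that `m (A g) = m A` for all `g` in `G` and all subsets `A` of `X`. -/
def IsAmenableRightSet (G : Type*) [Group G] (X : Type*) [MulAction Gᵐᵒᵖ X] : Prop :=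
  ∃ m : Set X → ℝ, IsMean m ∧
    ∀ (g : G) (A : Set X), m ((fun x : X => MulOpposite.op g • x) '' A) = m A

/-- A group is amenable if all its non-empty right `G`-sets are amenable. -/
def IsAmenableGroup (G : Type u) [Group G] : Prop :=
  ∀ (X : Type v) [MulAction Gᵐᵒᵖ X] [Nonempty X], IsAmenableRightSet G X

/-- The set of angles `{g x - x | x ∈ ℝ/ℤ}` of a self-map of the circle. -/
def angles (g : UnitAddCircle → UnitAddCircle) : Set UnitAddCircle :=
  Set.range fun x => g x - x

/-- An interval exchange: a permutation of the circle `ℝ/ℤ` that is right-continuous,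
has only finitely many angles, and is piecewise a translation, with finitely many pieces. -/
structure IsIntervalExchange (g : Equiv.Perm UnitAddCircle) : Prop where
  right_continuous : ∀ x : ℝ,
    ContinuousWithinAt (fun t : ℝ => g (t : UnitAddCircle)) (Ici x) x
  finite_angles : (angles g).Finite
  finite_discontinuities : {x : UnitAddCircle | ¬ ContinuousAt g x}.Finite

/-- A function whose displacement takes finitely many values and converges is eventually
equal to a translation. -/
theorem IsIntervalExchange.eventually_displacement {g : Equiv.Perm UnitAddCircle}
    (hg : IsIntervalExchange g) {α : Type*} {l : Filter α} {u : α → UnitAddCircle}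
    {x : UnitAddCircle} (hu : Tendsto u l (𝓝 x)) (hgu : Tendsto (fun a => g (u a)) l (𝓝 (g x))) :
    ∀ᶠ a in l, g (u a) = u a + (g x - x) := by
  have h1 : Tendsto (fun a => g (u a) - u a) l (𝓝 (g x - x)) := hgu.sub hu
  have h2 : (angles g \ {g x - x})ᶜ ∈ 𝓝 (g x - x) :=
    (hg.finite_angles.subset sdiff_subset).isClosed.isOpen_compl.mem_nhds (by simp)
  filter_upwards [h1 h2] with a ha
  have h3 : g (u a) - u a = g x - x := by
    by_contra hne
    exact ha ⟨⟨u a, rfl⟩, hne⟩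
  rw [← h3]; abel

theorem IsIntervalExchange.eventually_right {g : Equiv.Perm UnitAddCircle}
    (hg : IsIntervalExchange g) (x : ℝ) :
    ∀ᶠ t : ℝ in 𝓝[≥] x, g (t : UnitAddCircle) = (t : UnitAddCircle) + (g x - x) :=
  hg.eventually_displacement
    ((AddCircle.continuous_mk' (1 : ℝ)).continuousAt.continuousWithinAt (s := Ici x))
    (hg.right_continuous x)

theorem IsIntervalExchange.eventually_of_continuousAt {g : Equiv.Perm UnitAddCircle}
    (hg : IsIntervalExchange g) {x : UnitAddCircle} (hx : ContinuousAt g x) :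
    ∀ᶠ y in 𝓝 x, g y = y + (g x - x) :=
  hg.eventually_displacement tendsto_id hx

theorem tendsto_add_right (x c : ℝ) : Tendsto (fun t : ℝ => t + c) (𝓝[≥] x) (𝓝[≥] (x + c)) := by
  refine tendsto_nhdsWithin_iff.2 ⟨?_, ?_⟩
  · exact ((continuous_id.add continuous_const).tendsto x).mono_left nhdsWithin_le_nhds
  · filter_upwards [self_mem_nhdsWithin] with t ht
    simpa using ht

theorem IsIntervalExchange.one : IsIntervalExchange 1 where
  right_continuous x :=
    (AddCircle.continuous_mk' (1 : ℝ)).continuousAt.continuousWithinAt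
  finite_angles := by simp [angles]
  finite_discontinuities := by
    convert Set.finite_empty (α := UnitAddCircle)
    refine eq_empty_of_forall_notMem fun x hx => hx ?_
    exact continuousAt_id

theorem IsIntervalExchange.mul {g h : Equiv.Perm UnitAddCircle}
    (hg : IsIntervalExchange g) (hh : IsIntervalExchange h) : IsIntervalExchange (g * h) where
  right_continuous x := by
    obtain ⟨c, hc⟩ := QuotientAddGroup.mk_surjective
      (h (x : UnitAddCircle) - (x : UnitAddCircle))
    change (c : UnitAddCircle) = _ at hc
    have hx : h (x : UnitAddCircle) = ((x + c : ℝ) : UnitAddCircle) := by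
      rw [AddCircle.coe_add, hc]; abel
    have h1 := (hg.right_continuous (x + c)).tendsto.comp (tendsto_add_right x c)
    rw [← hx] at h1
    refine Tendsto.congr' ?_ h1
    filter_upwards [hh.eventually_right x] with t ht
    simp [ht, ← hc]
  finite_angles := by
    refine (hg.finite_angles.add hh.finite_angles).subset ?_
    rintro _ ⟨x, rfl⟩
    exact ⟨_, ⟨h x, rfl⟩, _, ⟨x, rfl⟩, by simp⟩
  finite_discontinuities := by
    refine (hh.finite_discontinuities.union
      (hg.finite_discontinuities.preimage h.injective.injOn)).subset ?_
    intro x hx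
    by_contra hn
    simp only [mem_union, mem_preimage, mem_ofPred_eq, not_or, not_not] at hn
    exact hx (ContinuousAt.comp (f := h) (g := g) hn.2 hn.1)

theorem IsIntervalExchange.inv {g : Equiv.Perm UnitAddCircle}
    (hg : IsIntervalExchange g) : IsIntervalExchange g⁻¹ where
  right_continuous y := by
    obtain ⟨x, hx⟩ := QuotientAddGroup.mk_surjective (g⁻¹ (y : UnitAddCircle))
    change (x : UnitAddCircle) = _ at hx
    have hgx : g (x : UnitAddCircle) = y := by rw [hx]; simp
    have h1 : Tendsto (fun t : ℝ => t + (x - y)) (𝓝[≥] y) (𝓝[≥] x) := by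
      simpa using tendsto_add_right y (x - y)
    have h2 : Tendsto (fun t : ℝ => ((t + (x - y) : ℝ) : UnitAddCircle)) (𝓝[≥] y)
        (𝓝 (x : UnitAddCircle)) :=
      ((AddCircle.continuous_mk' (1 : ℝ)).tendsto x).comp (h1.mono_right nhdsWithin_le_nhds)
    rw [hx] at h2
    refine Tendsto.congr' ?_ h2
    filter_upwards [h1.eventually (hg.eventually_right x)] with t ht
    rw [Equiv.Perm.eq_inv_iff_eq, ht, hgx, AddCircle.coe_add, AddCircle.coe_sub]
    abel
  finite_angles := by
    refine hg.finite_angles.neg.subset ?_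
    rintro _ ⟨x, rfl⟩
    exact ⟨g⁻¹ x, by simp⟩
  finite_discontinuities := by
    refine (hg.finite_discontinuities.image g).subset ?_
    intro y hy
    refine ⟨g⁻¹ y, fun hc => hy ?_, by simp⟩
    have h1 := hg.eventually_of_continuousAt hc
    have h2 : Tendsto (fun z : UnitAddCircle => z + (g⁻¹ y - y)) (𝓝 y) (𝓝 (g⁻¹ y)) := by
      have : Continuous fun z : UnitAddCircle => z + (g⁻¹ y - y) := by fun_prop
      simpa using this.tendsto y
    refine Tendsto.congr' ?_ h2
    filter_upwards [h2.eventually h1] with z hz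
    have h3 : g (g⁻¹ y) = y := by simp
    rw [Equiv.Perm.eq_inv_iff_eq, hz, h3]
    abel

/-- The group of interval exchanges. -/
def IET : Subgroup (Equiv.Perm UnitAddCircle) where
  carrier := {g | IsIntervalExchange g}
  one_mem' := IsIntervalExchange.one
  mul_mem' := IsIntervalExchange.mul
  inv_mem' := IsIntervalExchange.inv

/-- The subgroup of `IET` of interval exchanges all of whose angles lie in `Λ`. -/
def IETOver (Λ : AddSubgroup UnitAddCircle) : Subgroup IET where
  carrier := {g | angles (g : Equiv.Perm UnitAddCircle) ⊆ Λ}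
  one_mem' := by
    rintro _ ⟨x, rfl⟩
    simp
  mul_mem' := by
    rintro g h hg hh _ ⟨x, rfl⟩
    have := Λ.add_mem (hg ⟨(h : Equiv.Perm UnitAddCircle) x, rfl⟩) (hh ⟨x, rfl⟩)
    simpa using this
  inv_mem' := by
    rintro g hg _ ⟨x, rfl⟩
    have := Λ.neg_mem (hg ⟨(g : Equiv.Perm UnitAddCircle)⁻¹ x, rfl⟩)
    simpa using this

/-! ### Random finite subsets with independent points -/

/-! An interval exchange group `G` acts on the circle in two ways: by its right-continuous
permutations `ρ` and by their left-continuous versions `σ`. For each group element the two differ at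
finitely many points. If they coincide, the element is a rotation, hence trivial once it fixes a
point.

A finite set `E` carries finitely many markings: an enumeration `l` of `E` and a permutation `f`
supported in `E`. The twisted action `g · (l, f) = (ρ g l, σ g f (ρ g)⁻¹)` sends markings of `E` to
markings of `ρ g E` as soon as `E` contains the points where `ρ g` and `σ g` differ, and stabilisers
of markings of non-empty sets are trivial (`eq_one_of_twistedAction_eq`). An equivariant map to `G`
therefore pushes the uniform measure on markings of `E` to a probability on `G` that depends
equivariantly on `E` (`markFreq_map`).

It remains to choose `E` at random, almost invariantly in law, while forcing it to contain a given
finite set. Points are selected independently with probabilities `sin² θ`; the law is almost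
invariant when `θ` has small `ℓ²` variation (`sq_bernoulliExp_map_sub_le`). Such `θ`, equal to `π /
2` on a given finite set, exist because groups of rank at most two have zero capacity, by
logarithmic cutoffs on `ℤ × ℤ` (`hasZeroCapacity_of_rank_le_two`). Averaging over `E` and passing to
a limit gives an invariant mean (`exists_leftInvariant_mean_of_capacity`). -/

theorem one_sub_sum_le_prod_one_sub {ι : Type*} (s : Finset ι) (f : ι → ℝ)
    (h0 : ∀ i ∈ s, 0 ≤ f i) (h1 : ∀ i ∈ s, f i ≤ 1) :
    1 - ∑ i ∈ s, f i ≤ ∏ i ∈ s, (1 - f i) := by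
  classical
  induction s using Finset.induction_on with
  | empty => simp
  | insert a s ha ih =>
    rw [Finset.sum_insert ha, Finset.prod_insert ha]
    have hi := ih (fun i hi => h0 i (Finset.mem_insert_of_mem hi))
      (fun i hi => h1 i (Finset.mem_insert_of_mem hi))
    have hs : 0 ≤ ∑ i ∈ s, f i :=
      Finset.sum_nonneg fun i hi => h0 i (Finset.mem_insert_of_mem hi)
    have ha0 := h0 a (Finset.mem_insert_self a s)
    have ha1 := h1 a (Finset.mem_insert_self a s)
    nlinarith

theorem one_sub_le_prod_cos {X : Type*} (δ : X → ℝ) (F : Finset X) (hδ : ∀ x, |δ x| ≤ Real.pi / 2) :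
    1 - (∑ x ∈ F, δ x ^ 2) / 2 ≤ ∏ x ∈ F, Real.cos (δ x) := by
  have h := one_sub_sum_le_prod_one_sub F (fun x => 1 - Real.cos (δ x))
    (fun x _ => by linarith [Real.cos_le_one (δ x)])
    (fun x _ => by linarith [Real.cos_nonneg_of_mem_Icc (abs_le.1 (hδ x))])
  simp only [sub_sub_cancel] at h
  refine le_trans ?_ h
  rw [Finset.sum_div]
  have := Finset.sum_le_sum fun x (_ : x ∈ F) =>
    (show 1 - Real.cos (δ x) ≤ δ x ^ 2 / 2 by
      linarith [Real.one_sub_sq_div_two_le_cos (x := δ x)])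
  linarith

section Bernoulli

variable {X : Type*} [DecidableEq X]

/-- The square root of the probability that a random subset of `F`, containing each point `x`
of `F` independently with probability `sin² (θ x)`, is equal to `E`. -/
noncomputable def bernoulliAmp (θ : X → ℝ) (F E : Finset X) : ℝ :=
  (∏ x ∈ E, Real.sin (θ x)) * ∏ x ∈ F \ E, Real.cos (θ x)

/-- The expected value of `φ E`, where `E` is a random subset of `F` containing each point `x`
of `F` independently with probability `sin² (θ x)`. -/
noncomputable def bernoulliExp (θ : X → ℝ) (F : Finset X) (φ : Finset X → ℝ) : ℝ :=
  ∑ E ∈ F.powerset, bernoulliAmp θ F E ^ 2 * φ E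

/-- This is the Hellinger affinity of two product laws. With probabilities written as `sin²`, each
factor is `cos θ cos θ' + sin θ sin θ'`, and expanding the product over the points gives the sum
over subsets. -/
theorem sum_bernoulliAmp_mul (θ θ' : X → ℝ) (F : Finset X) :
    ∑ E ∈ F.powerset, bernoulliAmp θ F E * bernoulliAmp θ' F E =
      ∏ x ∈ F, Real.cos (θ x - θ' x) := by
  simp_rw [Real.cos_sub]
  simp_rw [add_comm (Real.cos _ * Real.cos _)]
  rw [Finset.prod_add]
  refine Finset.sum_congr rfl fun E _ => ?_
  simp only [bernoulliAmp, Finset.prod_mul_distrib]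
  ring

theorem sum_bernoulliAmp_sq (θ : X → ℝ) (F : Finset X) :
    ∑ E ∈ F.powerset, bernoulliAmp θ F E ^ 2 = 1 := by
  simpa [sq] using sum_bernoulliAmp_mul θ θ F

/-- Total variation is controlled by Hellinger distance: apply Cauchy–Schwarz to `a² - b² = (a -
b)(a + b)`. The factor `a - b` has squared norm `2 - 2 ∑ a b`, which is second order in `θ - θ'`;
the other has squared norm at most `4`. -/
theorem sq_sum_abs_bernoulliAmp_sq_sub_le (θ θ' : X → ℝ) (F : Finset X)
    (h : ∀ x, |θ x - θ' x| ≤ Real.pi / 2) :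
    (∑ E ∈ F.powerset, |bernoulliAmp θ F E ^ 2 - bernoulliAmp θ' F E ^ 2|) ^ 2 ≤
      4 * ∑ x ∈ F, (θ x - θ' x) ^ 2 := by
  set a := bernoulliAmp θ F
  set b := bernoulliAmp θ' F
  have ha : ∑ E ∈ F.powerset, a E ^ 2 = 1 := sum_bernoulliAmp_sq θ F
  have hb : ∑ E ∈ F.powerset, b E ^ 2 = 1 := sum_bernoulliAmp_sq θ' F
  have hab : 1 - (∑ x ∈ F, (θ x - θ' x) ^ 2) / 2 ≤ ∑ E ∈ F.powerset, a E * b E :=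
    (one_sub_le_prod_cos _ F h).trans_eq (sum_bernoulliAmp_mul θ θ' F).symm
  have h1 : ∑ E ∈ F.powerset, |a E - b E| ^ 2 = 2 - 2 * ∑ E ∈ F.powerset, a E * b E := by
    have : ∀ E, |a E - b E| ^ 2 = a E ^ 2 + b E ^ 2 - 2 * (a E * b E) := fun E => by
      rw [sq_abs]; ring
    simp_rw [this]
    rw [Finset.sum_sub_distrib, Finset.sum_add_distrib, ha, hb, ← Finset.mul_sum]
    ring
  have h2 : ∑ E ∈ F.powerset, |a E + b E| ^ 2 ≤ 4 := by
    have : ∀ E, |a E + b E| ^ 2 ≤ 2 * a E ^ 2 + 2 * b E ^ 2 := fun E => by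
      rw [sq_abs]; nlinarith [sq_nonneg (a E - b E)]
    refine (Finset.sum_le_sum fun E _ => this E).trans ?_
    rw [Finset.sum_add_distrib, ← Finset.mul_sum, ← Finset.mul_sum, ha, hb]
    norm_num
  have h3 : ∀ E, |a E ^ 2 - b E ^ 2| = |a E - b E| * |a E + b E| := fun E => by
    rw [← abs_mul]; congr 1; ring
  simp_rw [h3]
  refine (Finset.sum_mul_sq_le_sq_mul_sq _ _ _).trans ?_
  have h4 : 0 ≤ ∑ E ∈ F.powerset, |a E - b E| ^ 2 := Finset.sum_nonneg fun _ _ => by positivity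
  nlinarith

theorem bernoulliExp_subset (θ : X → ℝ) {F F' : Finset X} (hF : F ⊆ F')
    (hθ : ∀ x ∉ F, θ x = 0) (φ : Finset X → ℝ) :
    bernoulliExp θ F φ = bernoulliExp θ F' φ := by
  have h : ∀ E ∈ F.powerset, bernoulliAmp θ F E = bernoulliAmp θ F' E := by
    intro E _
    simp only [bernoulliAmp]
    congr 1
    refine Finset.prod_subset (Finset.sdiff_subset_sdiff hF le_rfl) fun x hx hx' => ?_
    have : x ∉ F := fun hxF => hx' (Finset.mem_sdiff.2 ⟨hxF, (Finset.mem_sdiff.1 hx).2⟩)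
    rw [hθ x this, Real.cos_zero]
  unfold bernoulliExp
  rw [Finset.sum_congr rfl fun E hE => by rw [h E hE]]
  refine Finset.sum_subset (Finset.powerset_mono.2 hF) fun E _ hE => ?_
  obtain ⟨x, hxE, hxF⟩ := Finset.not_subset.1 (mt Finset.mem_powerset.2 hE)
  have : bernoulliAmp θ F' E = 0 := by
    rw [bernoulliAmp, Finset.prod_eq_zero hxE (by rw [hθ x hxF, Real.sin_zero]), zero_mul]
  simp [this]

theorem bernoulliExp_map (θ : X → ℝ) (F : Finset X) (e : Equiv.Perm X) (φ : Finset X → ℝ) :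
    bernoulliExp θ F (fun E => φ (E.map e.toEmbedding)) =
      bernoulliExp (fun x => θ (e.symm x)) (F.map e.toEmbedding) φ := by
  unfold bernoulliExp
  refine Finset.sum_bij (fun E _ => E.map e.toEmbedding) ?_ ?_ ?_ ?_
  · intro E hE
    exact Finset.mem_powerset.2 (Finset.map_subset_map.2 (Finset.mem_powerset.1 hE))
  · intro E _ E' _ h
    exact Finset.map_injective _ h
  · intro E hE
    refine ⟨E.map e.symm.toEmbedding, ?_, ?_⟩
    · rw [Finset.mem_powerset] at hE ⊢
      intro x hx
      obtain ⟨y, hy, rfl⟩ := Finset.mem_map.1 hx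
      obtain ⟨z, hz, rfl⟩ := Finset.mem_map.1 (hE hy)
      simpa using hz
    · ext x
      simp
  · intro E _
    simp only [bernoulliAmp, ← Finset.map_sdiff, Finset.prod_map]
    simp

/-- Points with angle `π / 2` are selected almost surely, so only sets containing all of them
matter. -/
theorem bernoulliExp_congr (θ : X → ℝ) (F : Finset X) {φ ψ : Finset X → ℝ} {E₀ : Finset X}
    (hF : E₀ ⊆ F) (hθ : ∀ x ∈ E₀, θ x = Real.pi / 2) (h : ∀ E, E₀ ⊆ E → φ E = ψ E) :
    bernoulliExp θ F φ = bernoulliExp θ F ψ := by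
  refine Finset.sum_congr rfl fun E _ => ?_
  by_cases hE : E₀ ⊆ E
  · rw [h E hE]
  · obtain ⟨x, hx, hxE⟩ := Finset.not_subset.1 hE
    have : bernoulliAmp θ F E = 0 := by
      rw [bernoulliAmp, Finset.prod_eq_zero (i := x) (s := F \ E)
        (Finset.mem_sdiff.2 ⟨hF hx, hxE⟩) (by rw [hθ x hx, Real.cos_pi_div_two]), mul_zero]
    simp [this]

theorem sq_bernoulliExp_sub_le (θ θ' : X → ℝ) (F : Finset X)
    (h : ∀ x, |θ x - θ' x| ≤ Real.pi / 2) {φ : Finset X → ℝ} (h0 : ∀ E, 0 ≤ φ E)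
    (h1 : ∀ E, φ E ≤ 1) :
    (bernoulliExp θ F φ - bernoulliExp θ' F φ) ^ 2 ≤ 4 * ∑ x ∈ F, (θ x - θ' x) ^ 2 := by
  refine le_trans (sq_le_sq' ?_ ?_) (sq_sum_abs_bernoulliAmp_sq_sub_le θ θ' F h) <;>
  simp only [bernoulliExp, ← Finset.sum_sub_distrib, ← Finset.sum_neg_distrib] <;>
  refine Finset.sum_le_sum fun E _ => ?_
  · nlinarith [h0 E, h1 E, neg_abs_le (bernoulliAmp θ F E ^ 2 - bernoulliAmp θ' F E ^ 2),
      abs_nonneg (bernoulliAmp θ F E ^ 2 - bernoulliAmp θ' F E ^ 2)]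
  · nlinarith [h0 E, h1 E, le_abs_self (bernoulliAmp θ F E ^ 2 - bernoulliAmp θ' F E ^ 2),
      abs_nonneg (bernoulliAmp θ F E ^ 2 - bernoulliAmp θ' F E ^ 2)]

/-- The expectation is almost invariant under a permutation along which `θ` varies little. -/
theorem sq_bernoulliExp_map_sub_le (θ : X → ℝ) (F : Finset X) (e : Equiv.Perm X) (ε : ℝ)
    (hF : ∀ x ∉ F, θ x = 0) (h0 : ∀ x, 0 ≤ θ x) (h1 : ∀ x, θ x ≤ Real.pi / 2)
    (he : ∀ s : Finset X, ∑ x ∈ s, (θ (e x) - θ x) ^ 2 ≤ ε)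
    {φ : Finset X → ℝ} (hφ0 : ∀ E, 0 ≤ φ E) (hφ1 : ∀ E, φ E ≤ 1) :
    (bernoulliExp θ F φ - bernoulliExp θ F fun E => φ (E.map e.toEmbedding)) ^ 2 ≤ 4 * ε := by
  rw [bernoulliExp_map, bernoulliExp_subset θ (F' := F ∪ F.map e.toEmbedding)
    Finset.subset_union_left hF, bernoulliExp_subset (fun x => θ (e.symm x))
    (F' := F ∪ F.map e.toEmbedding) Finset.subset_union_right]
  · refine (sq_bernoulliExp_sub_le _ _ _ ?_ hφ0 hφ1).trans ?_
    · intro x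
      rw [abs_le]
      constructor <;> linarith [h0 x, h1 x, h0 (e.symm x), h1 (e.symm x)]
    · have := he ((F ∪ F.map e.toEmbedding).map e.symm.toEmbedding)
      rw [Finset.sum_map] at this
      simp only [Equiv.coe_toEmbedding, Equiv.apply_symm_apply] at this
      linarith
  · intro x hx
    refine hF _ fun hx' => hx ?_
    exact Finset.mem_map.2 ⟨_, hx', by simp⟩

end Bernoulli

/-! ### Invariant means from almost invariant random finite subsets -/

/-- Pick a representative in each orbit and let `π y` carry it to `y`. Equivariance at `y` only
needs the stabiliser of `y` to be trivial, so the action need not be free elsewhere. -/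
theorem exists_map_smul_eq_mul_of_free (G Y : Type*) [Group G] [MulAction G Y] :
    ∃ π : Y → G, ∀ (g : G) (y : Y), (∀ h : G, h • y = y → h = 1) → π (g • y) = g * π y := by
  let r : Y → Y := fun y => Quotient.out (Quotient.mk (MulAction.orbitRel G Y) y)
  have hr : ∀ y, ∃ g : G, g • r y = y := fun y => by
    let _ := MulAction.orbitRel G Y
    have h : y ≈ r y := Setoid.symm (Quotient.mk_out y)
    exact h
  choose π hπ using hr
  refine ⟨π, fun g y hy => ?_⟩
  have hrg : r (g • y) = r y := by
    have : Quotient.mk (MulAction.orbitRel G Y) (g • y) =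
        Quotient.mk (MulAction.orbitRel G Y) y := Quotient.sound ⟨g, rfl⟩
    simp only [r, this]
  have h1 : (g⁻¹ * (π (g • y) * (π y)⁻¹)) • y = y := by
    have h2 : (π y)⁻¹ • y = r y := by rw [inv_smul_eq_iff, hπ]
    rw [mul_smul, mul_smul, h2, ← hrg, hπ, inv_smul_smul]
  have h3 := hy _ h1
  rw [inv_mul_eq_one, eq_mul_inv_iff_mul_eq] at h3
  exact h3.symm

section Markings

variable {G X : Type*} (π : List X × Equiv.Perm X → G)

/-- The enumerations of a finite set, together with a permutation supported in this set. -/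
def markings (E : Finset X) : Set (List X × Equiv.Perm X) :=
  {p | (p.1 : Multiset X) = E.val ∧ ∀ x ∉ E, p.2 x = x}

theorem markings_nonempty (E : Finset X) : (markings E).Nonempty :=
  ⟨(E.toList, 1), by simp [markings]⟩

theorem markings_finite (E : Finset X) : (markings E).Finite := by
  classical
  have h1 : {l : List X | (l : Multiset X) = E.val}.Finite := by
    refine (List.finite_toSet E.toList.permutations).subset fun l hl => ?_
    change l ∈ E.toList.permutations
    rw [List.mem_permutations, ← Multiset.coe_eq_coe, Finset.coe_toList]
    exact hl
  have h2 : {f : Equiv.Perm X | ∀ x ∉ E, f x = x}.Finite :=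
    Set.finite_coe_iff.1 (Finite.of_equiv _ (Equiv.Perm.subtypeEquivSubtypePerm (· ∈ E)))
  exact (h1.prod h2).subset fun p hp => ⟨hp.1, hp.2⟩

/-- The proportion of the markings of `E` that are mapped into `A` by `π`. -/
noncomputable def markFreq (π : List X × Equiv.Perm X → G) (E : Finset X) (A : Set G) : ℝ :=
  (markings E ∩ π ⁻¹' A).ncard / (markings E).ncard

theorem markFreq_nonneg (E : Finset X) (A : Set G) : 0 ≤ markFreq π E A := by
  unfold markFreq
  positivity

theorem markings_ncard_pos (E : Finset X) : (0 : ℝ) < (markings E).ncard :=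
  Nat.cast_pos.2 ((Set.ncard_pos (markings_finite E)).2 (markings_nonempty E))

theorem markFreq_univ (E : Finset X) : markFreq π E univ = 1 := by
  unfold markFreq
  rw [preimage_univ, inter_univ, div_self (markings_ncard_pos E).ne']

theorem markFreq_le_one (E : Finset X) (A : Set G) : markFreq π E A ≤ 1 := by
  unfold markFreq
  rw [div_le_one (markings_ncard_pos E)]
  exact_mod_cast Set.ncard_le_ncard inter_subset_left (markings_finite E)

theorem markFreq_union (E : Finset X) {A B : Set G} (h : Disjoint A B) :
    markFreq π E (A ∪ B) = markFreq π E A + markFreq π E B := by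
  unfold markFreq
  rw [preimage_union, inter_union_distrib_left, Set.ncard_union_eq
    ((h.preimage π).mono inter_subset_right inter_subset_right)
    ((markings_finite E).subset inter_subset_left)
    ((markings_finite E).subset inter_subset_left)]
  push_cast
  ring

end Markings

/-! ### The twisted action on markings and its freeness -/

section Twisted

variable {G X : Type*} [Group G] (ρ σ : G →* Equiv.Perm X)

/-- The action of `G` on pairs of a list of points and a permutation induced by
two actions of `G` on `X`. -/
@[reducible] def twistedAction : MulAction G (List X × Equiv.Perm X) where
  smul g p := (p.1.map (ρ g), σ g * p.2 * (ρ g)⁻¹)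
  one_smul p := by
    change (p.1.map (ρ 1), σ 1 * p.2 * (ρ 1)⁻¹) = p
    simp
  mul_smul g h p := by
    change (p.1.map (ρ (g * h)), σ (g * h) * p.2 * (ρ (g * h))⁻¹) =
      ((p.1.map (ρ h)).map (ρ g), σ g * (σ h * p.2 * (ρ h)⁻¹) * (ρ g)⁻¹)
    simp [mul_assoc]

theorem twistedAction_smul (g : G) (p : List X × Equiv.Perm X) :
    (twistedAction ρ σ).smul g p = (p.1.map (ρ g), σ g * p.2 * (ρ g)⁻¹) := rfl

/-- Outside `ρ g E`, applying `(ρ g)⁻¹` lands outside `E`, where `p.2` is the identity and `σ g`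
undoes `(ρ g)⁻¹`. -/
theorem twistedAction_mem_markings {g : G} {E : Finset X} (hE : ∀ x ∉ E, ρ g x = σ g x)
    {p : List X × Equiv.Perm X} (hp : p ∈ markings E) :
    (twistedAction ρ σ).smul g p ∈ markings (E.map (ρ g).toEmbedding) := by
  refine ⟨?_, fun x hx => ?_⟩
  · rw [twistedAction_smul, Finset.map_val, ← hp.1]
    rfl
  · have hx' : (ρ g)⁻¹ x ∉ E := fun h => hx (Finset.mem_map.2 ⟨_, h, by simp⟩)
    rw [twistedAction_smul]
    simp only [Equiv.Perm.mul_apply]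
    rw [hp.2 _ hx', ← hE _ hx']
    simp

theorem twistedAction_image_markings {g : G} {E : Finset X} (hE : ∀ x ∉ E, ρ g x = σ g x) :
    (twistedAction ρ σ).smul g '' markings E = markings (E.map (ρ g).toEmbedding) := by
  let _ := twistedAction ρ σ
  refine Subset.antisymm ?_ fun p hp => ?_
  · rintro _ ⟨p, hp, rfl⟩
    exact twistedAction_mem_markings ρ σ hE hp
  · refine ⟨g⁻¹ • p, ?_, smul_inv_smul g p⟩
    have h := twistedAction_mem_markings ρ σ (g := g⁻¹) (E := E.map (ρ g).toEmbedding) ?_ hp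
    · have hEE : (E.map (ρ g).toEmbedding).map (ρ g⁻¹).toEmbedding = E := by
        rw [Finset.map_map, map_inv]
        convert Finset.map_refl
        ext x
        simp
      rw [hEE] at h
      exact h
    · intro x hx
      have hx' : (ρ g)⁻¹ x ∉ E := fun h => hx (Finset.mem_map.2 ⟨_, h, by simp⟩)
      have h1 := hE _ hx'
      rw [map_inv, map_inv, Equiv.Perm.eq_inv_iff_eq, ← h1]
      simp

/-- Fixing the enumeration makes `ρ g` trivial on `E`, and fixing `f` makes `σ g` conjugate to `ρ g`
by `f`. As `f` preserves `E` and is trivial off it, the two permutations agree on both parts, and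
`hfree` applies at a point of `E`. -/
theorem eq_one_of_twistedAction_eq
    (hfree : ∀ g, ρ g = σ g → ∀ x, ρ g x = x → g = 1) {E : Finset X} (hE : E.Nonempty)
    {p : List X × Equiv.Perm X} (hp : p ∈ markings E) {g : G}
    (hg : (twistedAction ρ σ).smul g p = p) : g = 1 := by
  rw [twistedAction_smul] at hg
  obtain ⟨l, f⟩ := p
  simp only [Prod.mk.injEq] at hg
  obtain ⟨hl, hf⟩ := hg
  obtain ⟨hp1, hp2⟩ := hp
  simp only at hp1 hp2
  have hmem : ∀ x, x ∈ l ↔ x ∈ E := fun x => by rw [← Finset.mem_val, ← hp1, Multiset.mem_coe]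
  have hfix : ∀ x ∈ E, ρ g x = x := by
    have h : l.map (ρ g) = l.map id := by rw [hl, List.map_id]
    intro x hx
    exact List.map_inj_left.1 h x ((hmem x).2 hx)
  have hcomm : ∀ x, σ g (f x) = f (ρ g x) := fun x => by
    have := congrArg (fun e : Equiv.Perm X => e (ρ g x)) hf
    simpa using this
  obtain ⟨x₀, hx₀⟩ := hE
  refine hfree g ?_ x₀ (hfix x₀ hx₀)
  ext x
  by_cases hx : x ∈ E
  · have hfx : f⁻¹ x ∈ E := by
      by_contra h
      have h1 := hp2 _ h
      rw [← h1] at h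
      simp [hx] at h
    have h2 := hcomm (f⁻¹ x)
    rw [hfix _ hfx] at h2
    rw [show f (f⁻¹ x) = x by simp] at h2
    rw [hfix x hx, h2]
  · have hgx : ρ g x ∉ E := fun h => by
      have h1 := hfix _ h
      rw [(ρ g).injective h1] at h
      exact hx h
    rw [← hp2 _ hgx, ← hcomm, hp2 _ hx]

variable (π : List X × Equiv.Perm X → G)

theorem markFreq_map {g : G} {E : Finset X} (hE : ∀ x ∉ E, ρ g x = σ g x)
    (hπ : ∀ p ∈ markings E, π ((twistedAction ρ σ).smul g p) = g * π p) (A : Set G) :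
    markFreq π (E.map (ρ g).toEmbedding) ((fun h => g * h) '' A) = markFreq π E A := by
  let _ := twistedAction ρ σ
  have hinj : Function.Injective ((twistedAction ρ σ).smul g) :=
    MulAction.injective (β := List X × Equiv.Perm X) g
  have h1 : markings (E.map (ρ g).toEmbedding) ∩ π ⁻¹' ((fun h => g * h) '' A) =
      (twistedAction ρ σ).smul g '' (markings E ∩ π ⁻¹' A) := by
    rw [← twistedAction_image_markings ρ σ hE]
    ext q
    constructor
    · rintro ⟨⟨p, hp, rfl⟩, hA⟩
      refine ⟨p, ⟨hp, ?_⟩, rfl⟩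
      rw [mem_preimage, hπ p hp] at hA
      obtain ⟨a, ha, hag⟩ := hA
      rw [mem_preimage, ← mul_left_cancel hag]
      exact ha
    · rintro ⟨p, ⟨hp, hA⟩, rfl⟩
      exact ⟨⟨p, hp, rfl⟩, by rw [mem_preimage, hπ p hp]; exact ⟨_, hA, rfl⟩⟩
  unfold markFreq
  rw [h1, ← twistedAction_image_markings ρ σ hE, Set.ncard_image_of_injective _ hinj,
    Set.ncard_image_of_injective _ hinj]

end Twisted

/-- A limit of almost invariant finitely additive probabilities is invariant. -/
theorem exists_leftInvariant_mean_of_approx {G : Type*} [Group G]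
    (h : ∀ (S : Finset G) (ε : ℝ), 0 < ε → ∃ m : Set G → ℝ, IsMean m ∧
      ∀ g ∈ S, ∀ A, (m ((fun h => g * h) '' A) - m A) ^ 2 ≤ ε) :
    ∃ m : Set G → ℝ, IsMean m ∧ ∀ (g : G) (A : Set G), m ((fun h => g * h) '' A) = m A := by
  classical
  choose M hM hinv using fun i : Finset G × ℕ =>
    h i.1 (1 / ((i.2 : ℝ) + 1)) (by positivity)
  let U : Ultrafilter (Finset G × ℕ) := Ultrafilter.of atTop
  have hU : (U : Filter (Finset G × ℕ)) ≤ atTop := Ultrafilter.of_le _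
  obtain ⟨m, -, hm⟩ := (isCompact_univ_pi fun _ : Set G => isCompact_Icc (a := (0 : ℝ)) (b := 1)
    ).ultrafilter_le_nhds (U.map M)
    (by
      rw [le_principal_iff, Ultrafilter.mem_coe, Ultrafilter.mem_map]
      exact univ_mem' fun i A _ => ⟨(hM i).nonneg A, (hM i).le_one A⟩)
  have hlim : ∀ A, Tendsto (fun i => M i A) U (𝓝 (m A)) := tendsto_pi_nhds.1 hm
  refine ⟨m, ⟨fun A => ?_, fun A => ?_, ?_, fun A B hAB => ?_⟩, fun g A => ?_⟩
  · exact ge_of_tendsto' (hlim A) fun i => (hM i).nonneg A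
  · exact le_of_tendsto' (hlim A) fun i => (hM i).le_one A
  · exact tendsto_nhds_unique (hlim univ) (tendsto_const_nhds.congr fun i => (hM i).map_univ.symm)
  · exact tendsto_nhds_unique (hlim _)
      (((hlim A).add (hlim B)).congr fun i => ((hM i).map_union A B hAB).symm)
  · have h1 := ((hlim ((fun h => g * h) '' A)).sub (hlim A)).pow 2
    have h2 : Tendsto (fun i : Finset G × ℕ => 1 / ((i.2 : ℝ) + 1)) U (𝓝 0) := by
      refine Tendsto.mono_left ?_ hU
      rw [← prod_atTop_atTop_eq]
      exact tendsto_one_div_add_atTop_nhds_zero_nat.comp tendsto_snd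
    have h3 : (m ((fun h => g * h) '' A) - m A) ^ 2 ≤ 0 := by
      refine le_of_tendsto_of_tendsto h1 h2 ?_
      have : ∀ᶠ i : Finset G × ℕ in atTop, ({g}, 0) ≤ i := eventually_ge_atTop _
      filter_upwards [hU this] with i hi
      exact hinv i g (hi.1 (Finset.mem_singleton_self g)) A
    nlinarith

/-- Two actions of a group on a set which differ only at finitely many points for each group
element give rise to an invariant mean, if the first has zero capacity and the group elements
with a fixed point on which the two actions agree are trivial. -/
theorem exists_leftInvariant_mean_of_capacity {G X : Type*} [Group G] [Nonempty X]
    (ρ σ : G →* Equiv.Perm X) (hD : ∀ g, {x | ρ g x ≠ σ g x}.Finite)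
    (hfree : ∀ g, ρ g = σ g → ∀ x, ρ g x = x → g = 1)
    (hcap : ∀ (S : Finset G) (E₀ : Finset X) (ε : ℝ), 0 < ε → ∃ (θ : X → ℝ) (F : Finset X),
      (∀ x ∉ F, θ x = 0) ∧ (∀ x, 0 ≤ θ x) ∧ (∀ x, θ x ≤ Real.pi / 2) ∧
      (∀ x ∈ E₀, θ x = Real.pi / 2) ∧
      ∀ g ∈ S, ∀ s : Finset X, ∑ x ∈ s, (θ (ρ g x) - θ x) ^ 2 ≤ ε) :
    ∃ m : Set G → ℝ, IsMean m ∧ ∀ (g : G) (A : Set G), m ((fun h => g * h) '' A) = m A := by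
  classical
  refine exists_leftInvariant_mean_of_approx fun S ε hε => ?_
  obtain ⟨x₀⟩ := ‹Nonempty X›
  -- The point `x₀` keeps the random set non-empty, for freeness; the disagreement points of `S`
  -- make markings go to markings.
  let E₀ : Finset X := insert x₀ (S.biUnion fun g => (hD g).toFinset)
  obtain ⟨θ, F, hF, h0, h1, hE₀, hS⟩ := hcap S E₀ (ε / 4) (by positivity)
  have hE₀F : E₀ ⊆ F := fun x hx => by
    by_contra hxF
    linarith [hF x hxF, hE₀ x hx, Real.pi_pos]
  obtain ⟨π, hπ⟩ := @exists_map_smul_eq_mul_of_free G (List X × Equiv.Perm X) _ (twistedAction ρ σ)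
  refine ⟨fun A => bernoulliExp θ F fun E => markFreq π E A, ⟨fun A => ?_, fun A => ?_, ?_,
    fun A B hAB => ?_⟩, fun g hg A => ?_⟩
  · exact Finset.sum_nonneg fun E _ => mul_nonneg (sq_nonneg _) (markFreq_nonneg π E A)
  · rw [← sum_bernoulliAmp_sq θ F]
    exact Finset.sum_le_sum fun E _ => mul_le_of_le_one_right (sq_nonneg _) (markFreq_le_one π E A)
  · simp only [bernoulliExp, markFreq_univ, mul_one, sum_bernoulliAmp_sq]
  · simp only [bernoulliExp, markFreq_union π _ hAB, mul_add, Finset.sum_add_distrib]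
  · have h2 : bernoulliExp θ F (fun E => markFreq π E A) = bernoulliExp θ F fun E =>
        markFreq π (E.map (ρ g).toEmbedding) ((fun h => g * h) '' A) := by
      refine bernoulliExp_congr θ F hE₀F hE₀ fun E hE => ?_
      have hne : E.Nonempty := ⟨x₀, hE (Finset.mem_insert_self _ _)⟩
      refine (markFreq_map ρ σ π (fun x hx => ?_) (fun p hp => ?_) A).symm
      · by_contra hx'
        refine hx (hE (Finset.mem_insert_of_mem (Finset.mem_biUnion.2 ⟨g, hg, ?_⟩)))
        simpa using hx'
      · exact hπ g p fun h hh => eq_one_of_twistedAction_eq ρ σ hfree hne hp hh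
    simp only
    rw [h2]
    refine (sq_bernoulliExp_map_sub_le θ F (ρ g) (ε / 4) hF h0 h1 (hS g hg)
      (fun E => markFreq_nonneg π E _) (fun E => markFreq_le_one π E _)).trans ?_
    linarith

/-! ### The left-continuous version of an interval exchange -/

theorem tendsto_add_coe_left (x : UnitAddCircle) :
    Tendsto (fun t : ℝ => x + (t : UnitAddCircle)) (𝓝 0) (𝓝 x) := by
  have : Continuous fun t : ℝ => x + (t : UnitAddCircle) :=
    continuous_const.add (AddCircle.continuous_mk' (1 : ℝ))
  simpa using this.tendsto 0

theorem eventually_add_coe_ne (x : UnitAddCircle) :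
    ∀ᶠ t : ℝ in 𝓝[<] 0, x + (t : UnitAddCircle) ≠ x := by
  filter_upwards [Ioo_mem_nhdsLT (show (-1 : ℝ) < 0 by norm_num)] with t ht h
  rw [add_eq_left, AddCircle.coe_eq_zero_iff] at h
  obtain ⟨n, rfl⟩ := h
  obtain ⟨h1, h2⟩ := ht
  simp only [zsmul_eq_mul, mul_one] at h1 h2
  have h3 : -1 < n := by exact_mod_cast h1
  have h4 : n < 0 := by exact_mod_cast h2
  omega

/-- Just to the left of `x` there are no discontinuities, so the displacement is continuous on an
interval with values in a finite set, hence constant. -/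
theorem IsIntervalExchange.exists_left {g : Equiv.Perm UnitAddCircle}
    (hg : IsIntervalExchange g) (x : UnitAddCircle) :
    ∃ y : UnitAddCircle, ∀ᶠ t : ℝ in 𝓝[<] 0, g (x + (t : UnitAddCircle)) = y + t := by
  have h1 : ∀ᶠ t : ℝ in 𝓝[<] 0, ContinuousAt g (x + (t : UnitAddCircle)) := by
    have h2 : ({z | ¬ ContinuousAt g z} \ {x})ᶜ ∈ 𝓝 x :=
      (hg.finite_discontinuities.subset sdiff_subset).isClosed.isOpen_compl.mem_nhds (by simp)
    filter_upwards [(tendsto_add_coe_left x).mono_left nhdsWithin_le_nhds h2,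
      eventually_add_coe_ne x] with t ht hne
    by_contra hc
    exact ht ⟨hc, hne⟩
  obtain ⟨a, ha, ha'⟩ := (mem_nhdsLT_iff_exists_Ioo_subset' (show (-1 : ℝ) < 0 by norm_num)).1 h1
  obtain ⟨c, -, hc⟩ := (isPreconnected_Ioo (a := a) (b := (0 : ℝ))).eqOn_const_of_mapsTo
    (T := angles g) (f := fun t : ℝ => g (x + (t : UnitAddCircle)) - (x + (t : UnitAddCircle)))
    hg.finite_angles.isDiscrete
    (fun t ht => ContinuousAt.continuousWithinAt (by
      have h3 : ContinuousAt (fun t : ℝ => x + (t : UnitAddCircle)) t :=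
        (continuous_const.add (AddCircle.continuous_mk' (1 : ℝ))).continuousAt
      exact (ContinuousAt.comp (f := fun t : ℝ => x + (t : UnitAddCircle)) (g := g)
        (ha' ht) h3).sub h3))
    (fun t _ => ⟨_, rfl⟩) ⟨g 0 - 0, 0, rfl⟩
  refine ⟨x + c, ?_⟩
  filter_upwards [Ioo_mem_nhdsLT ha] with t ht
  have := hc ht
  simp only [Function.const_apply] at this
  rw [← this]
  abel

theorem eq_of_eventually_left {g : UnitAddCircle → UnitAddCircle} {x y z : UnitAddCircle}
    (hy : ∀ᶠ t : ℝ in 𝓝[<] 0, g (x + (t : UnitAddCircle)) = y + t)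
    (hz : ∀ᶠ t : ℝ in 𝓝[<] 0, g (x + (t : UnitAddCircle)) = z + t) : y = z := by
  obtain ⟨t, h1, h2⟩ := (hy.and hz).exists
  exact add_right_cancel (h1.symm.trans h2)

/-- The value at `x` of the left-continuous version of an interval exchange. -/
noncomputable def IET.leftValue (g : IET) (x : UnitAddCircle) : UnitAddCircle :=
  (IsIntervalExchange.exists_left g.2 x).choose

theorem IET.eventually_leftValue (g : IET) (x : UnitAddCircle) :
    ∀ᶠ t : ℝ in 𝓝[<] 0, (g : Equiv.Perm UnitAddCircle) (x + (t : UnitAddCircle)) =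
      IET.leftValue g x + t :=
  (IsIntervalExchange.exists_left g.2 x).choose_spec

theorem IET.leftValue_one (x : UnitAddCircle) : IET.leftValue 1 x = x :=
  eq_of_eventually_left (IET.eventually_leftValue 1 x) (Eventually.of_forall fun _ => rfl)

theorem IET.leftValue_mul (g h : IET) (x : UnitAddCircle) :
    IET.leftValue (g * h) x = IET.leftValue g (IET.leftValue h x) := by
  refine eq_of_eventually_left (IET.eventually_leftValue (g * h) x) ?_
  filter_upwards [IET.eventually_leftValue h x, IET.eventually_leftValue g (IET.leftValue h x)]
    with t h1 h2
  rw [← h2, ← h1]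
  rfl

/-- The left-continuous version of interval exchanges. -/
noncomputable def IET.leftPerm : IET →* Equiv.Perm UnitAddCircle :=
  MonoidHom.toHomPerm
    { toFun := fun g => (IET.leftValue g : Function.End UnitAddCircle)
      map_one' := funext IET.leftValue_one
      map_mul' := fun g h => funext (IET.leftValue_mul g h) }

theorem IET.leftPerm_apply (g : IET) (x : UnitAddCircle) :
    IET.leftPerm g x = IET.leftValue g x := rfl

theorem IET.leftPerm_eq_of_continuousAt (g : IET) {x : UnitAddCircle}
    (hx : ContinuousAt (g : Equiv.Perm UnitAddCircle) x) :
    IET.leftPerm g x = (g : Equiv.Perm UnitAddCircle) x := by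
  refine eq_of_eventually_left (IET.eventually_leftValue g x) ?_
  filter_upwards [(tendsto_add_coe_left x).mono_left nhdsWithin_le_nhds
    (IsIntervalExchange.eventually_of_continuousAt g.2 hx)] with t ht
  exact Eq.trans ht (by rw [add_right_comm, add_sub_cancel])

theorem IET.finite_leftPerm_ne (g : IET) :
    {x | (g : Equiv.Perm UnitAddCircle) x ≠ IET.leftPerm g x}.Finite :=
  (IsIntervalExchange.finite_discontinuities g.2).subset fun _ hx hc =>
    hx (IET.leftPerm_eq_of_continuousAt g hc).symm

theorem IET.eventually_right (g : IET) (x : UnitAddCircle) :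
    ∀ᶠ t : ℝ in 𝓝[≥] 0, (g : Equiv.Perm UnitAddCircle) (x + (t : UnitAddCircle)) =
      (g : Equiv.Perm UnitAddCircle) x + t := by
  obtain ⟨x, rfl⟩ := QuotientAddGroup.mk_surjective x
  have h := tendsto_add_right 0 x
  rw [zero_add] at h
  filter_upwards [h.eventually (IsIntervalExchange.eventually_right g.2 x)] with t ht
  rw [AddCircle.coe_add, add_comm (t : UnitAddCircle)] at ht
  refine ht.trans ?_
  change (x : UnitAddCircle) + t + (_ - (x : UnitAddCircle)) = _
  abel

/-- An interval exchange which is equal to its left-continuous version is a rotation. -/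
theorem IET.exists_eq_add_of_leftPerm_eq (g : IET)
    (h : (g : Equiv.Perm UnitAddCircle) = IET.leftPerm g) :
    ∃ c, ∀ x, (g : Equiv.Perm UnitAddCircle) x = x + c := by
  -- Translation germs on the left and on the right of `x` now match, so the displacement is locally
  -- constant; the circle being connected, it is constant.
  have hcont : Continuous fun x => (g : Equiv.Perm UnitAddCircle) x - x := by
    rw [continuous_iff_continuousAt]
    intro x
    have h1 : ∀ᶠ t : ℝ in 𝓝 0, (g : Equiv.Perm UnitAddCircle) (x + (t : UnitAddCircle)) =
        (g : Equiv.Perm UnitAddCircle) x + t := by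
      rw [← nhdsLT_sup_nhdsGE, eventually_sup]
      refine ⟨?_, IET.eventually_right g x⟩
      have := IET.eventually_leftValue g x
      rwa [← IET.leftPerm_apply, ← h] at this
    have h2 : ∀ᶠ y in 𝓝 x, (g : Equiv.Perm UnitAddCircle) y - y =
        (g : Equiv.Perm UnitAddCircle) x - x := by
      have h3 : ∀ᶠ z in 𝓝 (0 : UnitAddCircle), (g : Equiv.Perm UnitAddCircle) (x + z) =
          (g : Equiv.Perm UnitAddCircle) x + z := by
        have h4 : map ((↑) : ℝ → UnitAddCircle) (𝓝 0) = 𝓝 ((0 : ℝ) : UnitAddCircle) :=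
          (QuotientAddGroup.isOpenMap_coe).map_nhds_eq
            (AddCircle.continuous_mk' (1 : ℝ)).continuousAt
        rw [AddCircle.coe_zero] at h4
        rw [← h4]
        exact h1
      have h5 : Tendsto (fun y => y - x) (𝓝 x) (𝓝 (0 : UnitAddCircle)) := by
        have : Continuous fun y : UnitAddCircle => y - x := by fun_prop
        simpa using this.tendsto x
      filter_upwards [h5.eventually h3] with y hy
      rw [add_sub_cancel] at hy
      rw [hy]
      abel
    exact ((continuousAt_const (y := (g : Equiv.Perm UnitAddCircle) x - x)).congr
      (h2.mono fun _ hy => hy.symm))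
  obtain ⟨c, -, hc⟩ := (isPreconnected_univ (α := UnitAddCircle)).eqOn_const_of_mapsTo
    (T := angles (g : Equiv.Perm UnitAddCircle))
    (IsIntervalExchange.finite_angles g.2).isDiscrete hcont.continuousOn
    (fun t _ => ⟨_, rfl⟩) ⟨_, 0, rfl⟩
  exact ⟨c, fun x => by rw [← show _ = c from hc (mem_univ x), add_sub_cancel]⟩

theorem IET.eq_one_of_leftPerm_eq (g : IET)
    (h : (g : Equiv.Perm UnitAddCircle) = IET.leftPerm g) {x : UnitAddCircle}
    (hx : (g : Equiv.Perm UnitAddCircle) x = x) : g = 1 := by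
  obtain ⟨c, hc⟩ := IET.exists_eq_add_of_leftPerm_eq g h
  have : c = 0 := by
    have := hc x
    rwa [hx, eq_comm, add_eq_left] at this
  refine Subtype.ext (Equiv.ext fun y => ?_)
  rw [hc, this, add_zero]
  rfl

/-! ### Zero capacity of groups of rank at most two -/

/-- Partial sums of the harmonic series. -/
noncomputable def harmonicSum (n : ℕ) : ℝ := ∑ i ∈ Finset.range n, 1 / ((i : ℝ) + 1)

theorem harmonicSum_mono : Monotone harmonicSum := fun _ _ h =>
  Finset.sum_le_sum_of_subset_of_nonneg (Finset.range_mono h) fun _ _ _ => by positivity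

theorem harmonicSum_add_le (r k : ℕ) :
    harmonicSum (r + k) ≤ harmonicSum r + k * (1 / ((r : ℝ) + 1)) := by
  unfold harmonicSum
  rw [Finset.sum_range_add, add_le_add_iff_left]
  refine (Finset.sum_le_sum (g := fun _ => 1 / ((r : ℝ) + 1)) fun i _ => ?_).trans (by simp)
  refine one_div_le_one_div_of_le (by positivity) ?_
  push_cast
  linarith [(Nat.cast_nonneg i : (0 : ℝ) ≤ i)]

theorem abs_harmonicSum_sub_le {r r' k : ℕ} (h : r ≤ r' + k) (h' : r' ≤ r + k) :
    |harmonicSum r' - harmonicSum r| ≤ k * (k + 1) / ((r : ℝ) + 1) := by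
  have key : ∀ {a b : ℕ}, b ≤ a + k → harmonicSum b - harmonicSum a ≤ k / ((a : ℝ) + 1) :=
    fun {a b} hab => by
      have := (harmonicSum_mono hab).trans (harmonicSum_add_le a k)
      rw [mul_one_div] at this
      linarith
  have hk : (0 : ℝ) ≤ k := Nat.cast_nonneg k
  have hr0 : (0 : ℝ) ≤ r := Nat.cast_nonneg r
  have hr0' : (0 : ℝ) ≤ r' := Nat.cast_nonneg r'
  rw [abs_le']
  constructor
  · refine (key h').trans ?_
    gcongr
    nlinarith
  · have h1 := key h
    -- The factor `k + 1` pays for replacing `r'` by `r`: `r + 1 ≤ r' + k + 1 ≤ (k + 1) (r' + 1)`.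
    have h2 : (k : ℝ) / ((r' : ℝ) + 1) ≤ k * (k + 1) / ((r : ℝ) + 1) := by
      rw [div_le_div_iff₀ (by positivity) (by positivity), mul_assoc]
      have h3 : (r : ℝ) ≤ r' + k := by exact_mod_cast h
      refine mul_le_mul_of_nonneg_left ?_ hk
      nlinarith
    linarith

/-- The supremum norm on `ℤ × ℤ`. -/
def supNorm (v : ℤ × ℤ) : ℕ := max v.1.natAbs v.2.natAbs

theorem supNorm_add_le (v w : ℤ × ℤ) : supNorm (v + w) ≤ supNorm v + supNorm w := by
  simp only [supNorm, Prod.fst_add, Prod.snd_add]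
  omega

theorem supNorm_neg (v : ℤ × ℤ) : supNorm (-v) = supNorm v := by
  simp [supNorm]

theorem card_filter_supNorm_le (s : Finset (ℤ × ℤ)) (r : ℕ) :
    (s.filter fun v => supNorm v = r).card ≤ 8 * (r + 1) := by
  have h : (s.filter fun v => supNorm v = r) ⊆ Finset.box r := fun v hv =>
    Int.mem_box.2 (Finset.mem_filter.1 hv).2
  refine (Finset.card_le_card h).trans ?_
  rcases Nat.eq_zero_or_pos r with rfl | hr
  · simp
  · rw [Int.card_box hr.ne']
    omega

/-- Dimension two enters here: spheres grow linearly, so summing the inverse squares over each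
sphere leaves a harmonic term. -/
theorem sum_filter_supNorm_le (s : Finset (ℤ × ℤ)) (M : ℕ) :
    ∑ v ∈ s with supNorm v < M, (1 / ((supNorm v : ℝ) + 1)) ^ 2 ≤ 8 * harmonicSum M := by
  rw [← Finset.sum_fiberwise_of_maps_to (t := Finset.range M) (g := supNorm)
    (fun v hv => Finset.mem_range.2 (Finset.mem_filter.1 hv).2), harmonicSum, Finset.mul_sum]
  refine Finset.sum_le_sum fun r _ => ?_
  rw [Finset.sum_congr rfl (g := fun _ => (1 / ((r : ℝ) + 1)) ^ 2)
    (fun v hv => by rw [(Finset.mem_filter.1 hv).2]), Finset.sum_const, nsmul_eq_mul]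
  have h1 : ((Finset.filter (fun v => supNorm v = r)
      (Finset.filter (fun v => supNorm v < M) s)).card : ℝ) ≤ 8 * (r + 1) := by
    exact_mod_cast card_filter_supNorm_le _ r
  refine (mul_le_mul_of_nonneg_right h1 (by positivity)).trans_eq ?_
  have : (r : ℝ) + 1 ≠ 0 := by positivity
  field_simp

/-- Logarithmic cutoff function on `ℤ × ℤ`. -/
noncomputable def logCutoff (N : ℕ) (v : ℤ × ℤ) : ℝ :=
  max 0 (1 - harmonicSum (supNorm v) / harmonicSum N)

theorem logCutoff_eq_zero {N : ℕ} (hN : 0 < harmonicSum N) {v : ℤ × ℤ} (hv : N ≤ supNorm v) :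
    logCutoff N v = 0 := by
  refine max_eq_left ?_
  rw [sub_nonpos, one_le_div hN]
  exact harmonicSum_mono hv

theorem sq_logCutoff_sub_le {N k : ℕ} (hN : 0 < harmonicSum N) (v : ℤ × ℤ) {c : ℤ × ℤ}
    (hc : supNorm c ≤ k) :
    (logCutoff N (v + c) - logCutoff N v) ^ 2 ≤
      (k * (k + 1) / harmonicSum N) ^ 2 * (1 / ((supNorm v : ℝ) + 1)) ^ 2 := by
  have h1 : supNorm (v + c) ≤ supNorm v + k := (supNorm_add_le v c).trans (by omega)
  have h2 : supNorm v ≤ supNorm (v + c) + k := by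
    have := supNorm_add_le (v + c) (-c)
    rw [add_neg_cancel_right, supNorm_neg] at this
    omega
  rw [← mul_pow, sq_le_sq, abs_of_nonneg (a := _ * _) (by positivity)]
  refine (abs_max_sub_max_le_max _ _ _ _).trans ?_
  rw [sub_self, abs_zero, max_eq_right (abs_nonneg _), sub_sub_sub_cancel_left, ← sub_div, abs_div,
    abs_of_pos hN, abs_sub_comm]
  refine (div_le_div_of_nonneg_right (abs_harmonicSum_sub_le h2 h1) hN.le).trans_eq ?_
  ring

/-- Gradients are of size `1 / (r + 1)` divided by `harmonicSum N`, and their squares sum to order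
`1 / harmonicSum N`, since one harmonic sum is lost to the growth of spheres. -/
theorem sum_sq_logCutoff_sub_le {N k : ℕ} (hN : 0 < harmonicSum N) {c : ℤ × ℤ}
    (hc : supNorm c ≤ k) (s : Finset (ℤ × ℤ)) :
    ∑ v ∈ s, (logCutoff N (v + c) - logCutoff N v) ^ 2 ≤
      (k * (k + 1) / harmonicSum N) ^ 2 * (8 * (harmonicSum N + k)) := by
  have h1 : ∑ v ∈ s, (logCutoff N (v + c) - logCutoff N v) ^ 2 =
      ∑ v ∈ s with supNorm v < N + k, (logCutoff N (v + c) - logCutoff N v) ^ 2 := by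
    refine (Finset.sum_filter_of_ne fun v _ hv => ?_).symm
    by_contra h
    push Not at h
    have h2 : supNorm v ≤ supNorm (v + c) + k := by
      have := supNorm_add_le (v + c) (-c)
      rw [add_neg_cancel_right, supNorm_neg] at this
      omega
    refine hv ?_
    rw [logCutoff_eq_zero hN (show N ≤ supNorm v by omega),
      logCutoff_eq_zero hN (show N ≤ supNorm (v + c) by omega)]
    simp
  rw [h1]
  refine (Finset.sum_le_sum fun v _ => sq_logCutoff_sub_le hN v hc).trans ?_
  rw [← Finset.mul_sum]
  refine mul_le_mul_of_nonneg_left ((sum_filter_supNorm_le s _).trans ?_) (sq_nonneg _)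
  have h3 := harmonicSum_add_le N k
  have h4 : (k : ℝ) * (1 / ((N : ℝ) + 1)) ≤ k := by
    refine mul_le_of_le_one_right (Nat.cast_nonneg k) ?_
    rw [div_le_one (by positivity)]
    linarith [(Nat.cast_nonneg N : (0 : ℝ) ≤ N)]
  linarith

/-- An abelian group has zero capacity if there are finitely supported functions with value `1`
at the origin which are almost invariant in the `ℓ²` sense. -/
def HasZeroCapacity (A : Type*) [AddCommGroup A] : Prop :=
  ∀ (C : Finset A) (ε : ℝ), 0 < ε → ∃ (φ : A → ℝ) (F : Finset A), (∀ a ∉ F, φ a = 0) ∧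
    (∀ a, 0 ≤ φ a) ∧ (∀ a, φ a ≤ 1) ∧ φ 0 = 1 ∧
    ∀ c ∈ C, ∀ s : Finset A, ∑ a ∈ s, (φ (a + c) - φ a) ^ 2 ≤ ε

theorem hasZeroCapacity_int_prod_int : HasZeroCapacity (ℤ × ℤ) := by
  intro C ε hε
  let k := C.sup supNorm
  let D : ℝ := (k * (k + 1)) ^ 2 * 8
  have hD : 0 ≤ D := by positivity
  -- Beyond `k`, the factor `harmonicSum N + k` is at most `2 * harmonicSum N`, so the energy is at
  -- most `2 * D / harmonicSum N`.
  obtain ⟨N, hN⟩ := (Real.tendsto_sum_range_one_div_nat_succ_atTop.eventually_ge_atTop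
    (max (max 1 k) (2 * D / ε))).exists
  change _ ≤ harmonicSum N at hN
  have h1 : 1 ≤ harmonicSum N := ((le_max_left _ _).trans (le_max_left _ _)).trans hN
  have h2 : k ≤ harmonicSum N := ((le_max_right _ _).trans (le_max_left _ _)).trans hN
  have h3 : 2 * D / ε ≤ harmonicSum N := (le_max_right _ _).trans hN
  have h0 : 0 < harmonicSum N := by linarith
  refine ⟨logCutoff N, Finset.Icc (-(N : ℤ)) N ×ˢ Finset.Icc (-(N : ℤ)) N, fun v hv => ?_,
    fun v => le_max_left _ _, fun v => ?_, ?_, fun c hc s => ?_⟩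
  · refine logCutoff_eq_zero h0 ?_
    by_contra h
    refine hv ?_
    simp only [supNorm] at h
    rw [Finset.mem_product, Finset.mem_Icc, Finset.mem_Icc]
    omega
  · refine max_le zero_le_one ?_
    have : 0 ≤ harmonicSum (supNorm v) := Finset.sum_nonneg fun _ _ => by positivity
    have : 0 ≤ harmonicSum (supNorm v) / harmonicSum N := by positivity
    linarith
  · simp [logCutoff, supNorm, harmonicSum]
  · refine (sum_sq_logCutoff_sub_le h0 (Finset.le_sup hc) s).trans ?_
    change ((k : ℝ) * (k + 1) / harmonicSum N) ^ 2 * (8 * (harmonicSum N + k)) ≤ ε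
    rw [div_le_iff₀ hε] at h3
    have h4 : ((k : ℝ) * (k + 1) / harmonicSum N) ^ 2 * (8 * (harmonicSum N + k)) =
        D * (harmonicSum N + k) / harmonicSum N ^ 2 := by
      simp only [D]
      field_simp
    rw [h4, div_le_iff₀ (by positivity)]
    nlinarith

/-- Pull the cutoff back along `π`: fibres have at most as many points as the kernel, so energy
grows by at most that factor. -/
theorem HasZeroCapacity.of_finite_ker {A B : Type*} [AddCommGroup A] [AddCommGroup B]
    (hB : HasZeroCapacity B) (π : A →+ B) (hπ : (π.ker : Set A).Finite) : HasZeroCapacity A := by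
  classical
  intro C ε hε
  have hk : 0 < (π.ker : Set A).ncard := (Set.ncard_pos hπ).2 ⟨0, zero_mem _⟩
  set k := (π.ker : Set A).ncard
  have hk' : (0 : ℝ) < k := Nat.cast_pos.2 hk
  obtain ⟨φ, F, hF, h0, h1, hφ, hC⟩ := hB (C.image π) (ε / k) (by positivity)
  have himage : ∀ a : A, π ⁻¹' {π a} = (fun x => a + x) '' (π.ker : Set A) := fun a => by
    ext x
    refine ⟨fun hx => ⟨x - a, ?_, by simp⟩, ?_⟩
    · rw [mem_preimage, mem_singleton_iff] at hx
      simp [AddMonoidHom.mem_ker, hx]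
    · rintro ⟨y, hy, rfl⟩
      have : π y = 0 := hy
      simp [this]
  have hfib : ∀ b : B, (π ⁻¹' {b}).Finite ∧ (π ⁻¹' {b}).ncard ≤ k := fun b => by
    rcases (π ⁻¹' {b}).eq_empty_or_nonempty with h | ⟨a, rfl⟩
    · simp [h]
    · rw [himage]
      exact ⟨hπ.image _, Set.ncard_image_le hπ⟩
  have hfin : (π ⁻¹' (F : Set B)).Finite :=
    F.finite_toSet.preimage' fun b _ => (hfib b).1
  refine ⟨fun a => φ (π a), hfin.toFinset, fun a ha => hF _ (by simpa using ha), fun a => h0 _,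
    fun a => h1 _, by simpa using hφ, fun c hc s => ?_⟩
  simp only [map_add]
  rw [Finset.sum_comp (fun b => (φ (b + π c) - φ b) ^ 2) π]
  have hcard : ∀ b, ((s.filter fun a => π a = b).card : ℝ) ≤ k := fun b => by
    refine Nat.cast_le.2 (le_trans ?_ (hfib b).2)
    rw [← Set.ncard_coe_finset]
    exact Set.ncard_le_ncard (fun a ha => (Finset.mem_filter.1 ha).2) (hfib b).1
  have h2 : ∀ b ∈ s.image π, (s.filter fun a => π a = b).card • (φ (b + π c) - φ b) ^ 2 ≤
      k * (φ (b + π c) - φ b) ^ 2 := fun b _ => by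
    rw [nsmul_eq_mul]
    exact mul_le_mul_of_nonneg_right (hcard b) (sq_nonneg _)
  refine (Finset.sum_le_sum h2).trans ?_
  rw [← Finset.mul_sum]
  have h3 := hC (π c) (Finset.mem_image_of_mem π hc) (s.image π)
  rw [le_div_iff₀ hk'] at h3
  linarith

theorem exists_injective_finsupp_to_int_prod_int {n : ℕ} (hn : n ≤ 2) :
    ∃ f : (Fin n →₀ ℤ) →+ ℤ × ℤ, Function.Injective f := by
  interval_cases n
  · exact ⟨0, Function.injective_of_subsingleton _⟩
  · refine ⟨(Finsupp.applyAddHom 0).prod 0, fun a b h => ?_⟩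
    refine Finsupp.ext fun i => ?_
    fin_cases i
    exact congrArg Prod.fst h
  · refine ⟨(Finsupp.applyAddHom 0).prod (Finsupp.applyAddHom 1), fun a b h => ?_⟩
    refine Finsupp.ext fun i => ?_
    fin_cases i
    · exact congrArg Prod.fst h
    · exact congrArg Prod.snd h

/-- Flatness of `ℚ` over `ℤ` keeps the embedding injective after tensoring. -/
theorem le_of_rank_tensor_le {A : Type*} [AddCommGroup A] {n : ℕ} {d : ℕ}
    (f : (Fin n →₀ ℤ) →+ A) (hf : Function.Injective f) (h : Module.rank ℚ (ℚ ⊗[ℤ] A) ≤ d) :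
    n ≤ d := by
  have h1 : Function.Injective (LinearMap.lTensor ℚ f.toIntLinearMap) :=
    Module.Flat.lTensor_preserves_injective_linearMap _ hf
  have h2 := LinearMap.lift_rank_le_of_injective
    (f.toIntLinearMap.baseChange ℚ : ℚ ⊗[ℤ] (Fin n →₀ ℤ) →ₗ[ℚ] ℚ ⊗[ℤ] A) h1
  rw [Module.rank_baseChange] at h2
  simp only [rank_finsupp_self', Cardinal.mk_fin, Cardinal.lift_natCast] at h2
  have h3 := h2.trans (Cardinal.lift_le.2 h)
  simpa using h3

theorem hasZeroCapacity_of_rank_le_two {A : Type*} [AddCommGroup A] [AddGroup.FG A]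
    (h : Module.rank ℚ (ℚ ⊗[ℤ] A) ≤ 2) : HasZeroCapacity A := by
  obtain ⟨n, ι, _, p, hp, e, ⟨E⟩⟩ := AddCommGroup.equiv_free_prod_directSum_zmod A
  have hn : n ≤ 2 := le_of_rank_tensor_le
    (E.symm.toAddMonoidHom.comp (AddMonoidHom.inl _ _))
    (E.symm.injective.comp fun a b hab => congrArg Prod.fst hab) (by exact_mod_cast h)
  obtain ⟨f, hf⟩ := exists_injective_finsupp_to_int_prod_int hn
  have : ∀ i, NeZero (p i ^ e i) := fun i => ⟨pow_ne_zero _ (hp i).ne_zero⟩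
  have hT : Finite (DirectSum ι fun i => ZMod (p i ^ e i)) := by
    classical
    exact Finite.of_equiv _ (DirectSum.addEquivProd fun i => ZMod (p i ^ e i)).symm.toEquiv
  refine hasZeroCapacity_int_prod_int.of_finite_ker
    ((f.comp (AddMonoidHom.fst _ _)).comp E.toAddMonoidHom) ?_
  refine Set.Finite.of_finite_image (f := fun a => (E a).2) (Set.toFinite _) fun a ha b hb hab => ?_
  have key : ∀ a ∈ (((f.comp (AddMonoidHom.fst _ _)).comp E.toAddMonoidHom).ker : Set A),
      (E a).1 = 0 := fun a ha => hf (by rw [map_zero]; exact ha)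
  exact E.injective (Prod.ext ((key a ha).trans (key b hb).symm) hab)

/-! ### Amenability of groups of interval exchanges -/

/-- Transport the cutoff to the coset `x₀ + Λ` and extend by zero; translations by `Λ` preserve this
coset and its complement, so no boundary term appears. -/
theorem exists_coset_cutoff {A : Type*} [AddCommGroup A] {Λ : AddSubgroup A}
    (hΛ : HasZeroCapacity Λ) {C : Finset A} (hC : ∀ c ∈ C, c ∈ Λ) (x₀ : A) {ε : ℝ}
    (hε : 0 < ε) : ∃ (θ : A → ℝ) (F : Finset A), (∀ x ∉ F, θ x = 0) ∧ (∀ x, 0 ≤ θ x) ∧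
      (∀ x, θ x ≤ 1) ∧ θ x₀ = 1 ∧
      ∀ c ∈ C, ∀ s : Finset A, ∑ x ∈ s, (θ (x + c) - θ x) ^ 2 ≤ ε := by
  classical
  obtain ⟨φ, F, hF, h0, h1, hφ, hφC⟩ := hΛ (C.subtype (· ∈ Λ)) ε hε
  let j : Λ → A := fun a => x₀ + a
  have hj : Function.Injective j := fun a b h => Subtype.ext (add_left_cancel h)
  have hjmem : ∀ x, x ∉ Set.range j → x - x₀ ∉ Λ := fun x hx h => hx ⟨⟨_, h⟩, by simp [j]⟩
  let θ : A → ℝ := fun x => if h : x - x₀ ∈ Λ then φ ⟨x - x₀, h⟩ else 0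
  have hθj : ∀ a, θ (j a) = φ a := fun a => by simp [θ, j]
  have hθ : ∀ x, x - x₀ ∉ Λ → θ x = 0 := fun x hx => dif_neg hx
  refine ⟨θ, F.map ⟨j, hj⟩, fun x hx => ?_, fun x => ?_, fun x => ?_, ?_, fun c hc s => ?_⟩
  · by_cases h : x ∈ Set.range j
    · obtain ⟨a, rfl⟩ := h
      rw [hθj]
      exact hF a fun ha => hx (Finset.mem_map.2 ⟨a, ha, rfl⟩)
    · exact hθ x (hjmem x h)
  · by_cases h : x ∈ Set.range j
    · obtain ⟨a, rfl⟩ := h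
      rw [hθj]
      exact h0 a
    · rw [hθ x (hjmem x h)]
  · by_cases h : x ∈ Set.range j
    · obtain ⟨a, rfl⟩ := h
      rw [hθj]
      exact h1 a
    · rw [hθ x (hjmem x h)]
      exact zero_le_one
  · rw [← hφ, ← hθj]
    simp [j]
  · rw [← Finset.sum_preimage j s hj.injOn (fun x => (θ (x + c) - θ x) ^ 2)]
    · refine le_trans (le_of_eq (Finset.sum_congr rfl fun a _ => ?_))
        (hφC ⟨c, hC c hc⟩ (Finset.mem_subtype.2 hc) _)
      have : j a + c = j (a + ⟨c, hC c hc⟩) := by simp [j, add_assoc]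
      rw [this, hθj, hθj]
    · intro x _ hx
      have h2 := hjmem x hx
      have h3 : x + c - x₀ ∉ Λ := by
        rwa [add_sub_right_comm, Λ.add_mem_cancel_right (hC c hc)]
      simp [hθ _ h2, hθ _ h3]

/-- This lets cutoffs around several points be merged by taking maxima, with energies adding up. -/
theorem sq_max_sub_max_le (a b c d : ℝ) :
    (max a b - max c d) ^ 2 ≤ (a - c) ^ 2 + (b - d) ^ 2 := by
  have h := abs_max_sub_max_le_max a b c d
  rw [← sq_abs, ← sq_abs (a - c), ← sq_abs (b - d)]
  rcases le_max_iff.1 h with h | h <;>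
  nlinarith [abs_nonneg (max a b - max c d), sq_nonneg |a - c|, sq_nonneg |b - d|]

theorem exists_finset_cutoff {A : Type*} [AddCommGroup A] {Λ : AddSubgroup A}
    (hΛ : HasZeroCapacity Λ) {C : Finset A} (hC : ∀ c ∈ C, c ∈ Λ) (E : Finset A) {ε : ℝ}
    (hε : 0 < ε) : ∃ (θ : A → ℝ) (F : Finset A), (∀ x ∉ F, θ x = 0) ∧ (∀ x, 0 ≤ θ x) ∧
      (∀ x, θ x ≤ 1) ∧ (∀ x ∈ E, θ x = 1) ∧
      ∀ c ∈ C, ∀ s : Finset A, ∑ x ∈ s, (θ (x + c) - θ x) ^ 2 ≤ ε := by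
  classical
  induction E using Finset.induction_on generalizing ε with
  | empty => exact ⟨0, ∅, by simp, by simp, by simp, by simp, by simp [hε.le]⟩
  | insert x₀ E _ ih =>
    obtain ⟨θ, F, hF, h0, h1, hE, hs⟩ := ih (half_pos hε)
    obtain ⟨θ', F', hF', h0', h1', hE', hs'⟩ := exists_coset_cutoff hΛ hC x₀ (half_pos hε)
    refine ⟨fun x => max (θ x) (θ' x), F ∪ F', fun x hx => ?_, fun x => le_max_of_le_left (h0 x),
      fun x => max_le (h1 x) (h1' x), fun x hx => ?_, fun c hc s => ?_⟩
    · rw [Finset.mem_union, not_or] at hx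
      simp [hF x hx.1, hF' x hx.2]
    · rcases Finset.mem_insert.1 hx with rfl | hx
      · exact (max_eq_right ((h1 x).trans_eq hE'.symm)).trans hE'
      · exact (max_eq_left ((h1' x).trans_eq (hE x hx).symm)).trans (hE x hx)
    · refine (Finset.sum_le_sum fun x _ => sq_max_sub_max_le _ _ _ _).trans ?_
      rw [Finset.sum_add_distrib]
      linarith [hs c hc s, hs' c hc s]

theorem exists_cutoff_of_angles {Λ : AddSubgroup UnitAddCircle} (hΛ : HasZeroCapacity Λ)
    (S : Finset (IETOver Λ)) (E : Finset UnitAddCircle) {ε : ℝ} (hε : 0 < ε) :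
    ∃ (θ : UnitAddCircle → ℝ) (F : Finset UnitAddCircle), (∀ x ∉ F, θ x = 0) ∧ (∀ x, 0 ≤ θ x) ∧
      (∀ x, θ x ≤ Real.pi / 2) ∧ (∀ x ∈ E, θ x = Real.pi / 2) ∧
      ∀ g ∈ S, ∀ s : Finset UnitAddCircle,
        ∑ x ∈ s, (θ (((g : IET) : Equiv.Perm UnitAddCircle) x) - θ x) ^ 2 ≤ ε := by
  classical
  let a : IETOver Λ → Finset UnitAddCircle := fun g =>
    (IsIntervalExchange.finite_angles (g : IET).2).toFinset
  let C := S.biUnion a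
  have hC : ∀ c ∈ C, c ∈ Λ := fun c hc => by
    obtain ⟨g, -, hg⟩ := Finset.mem_biUnion.1 hc
    exact g.2 ((Set.Finite.mem_toFinset _).1 hg)
  -- The square accounts for rescaling by `π / 2`, the cardinality for summing over all angles; the
  -- `+ 1` keeps `K` positive when `C` is empty.
  let K : ℝ := (Real.pi / 2) ^ 2 * (C.card + 1)
  have hK : 0 < K := by positivity
  obtain ⟨θ, F, hF, h0, h1, hE, hs⟩ := exists_finset_cutoff hΛ hC E (div_pos hε hK)
  have hpi : 0 < Real.pi / 2 := by positivity
  refine ⟨fun x => Real.pi / 2 * θ x, F, fun x hx => by simp [hF x hx],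
    fun x => mul_nonneg hpi.le (h0 x), fun x => mul_le_of_le_one_right hpi.le (h1 x),
    fun x hx => by simp [hE x hx], fun g hg s => ?_⟩
  -- At each point `g` is translation by some angle in `C`; summing over all of `C` avoids tracking
  -- which one.
  have h2 : ∀ x, (θ (((g : IET) : Equiv.Perm UnitAddCircle) x) - θ x) ^ 2 ≤
      ∑ c ∈ C, (θ (x + c) - θ x) ^ 2 := fun x => by
    have hmem : ((g : IET) : Equiv.Perm UnitAddCircle) x - x ∈ C :=
      Finset.mem_biUnion.2 ⟨g, hg, (Set.Finite.mem_toFinset _).2 ⟨x, rfl⟩⟩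
    refine le_trans (le_of_eq ?_) (Finset.single_le_sum
      (f := fun c => (θ (x + c) - θ x) ^ 2) (fun _ _ => sq_nonneg _) hmem)
    simp
  simp_rw [← mul_sub, mul_pow]
  rw [← Finset.mul_sum]
  have h3 : ∑ x ∈ s, (θ (((g : IET) : Equiv.Perm UnitAddCircle) x) - θ x) ^ 2 ≤
      C.card * (ε / K) := by
    refine (Finset.sum_le_sum fun x _ => h2 x).trans ?_
    rw [Finset.sum_comm]
    refine (Finset.sum_le_sum fun c hc => hs c hc s).trans ?_
    rw [Finset.sum_const, nsmul_eq_mul]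
  calc (Real.pi / 2) ^ 2 * ∑ x ∈ s, (θ (((g : IET) : Equiv.Perm UnitAddCircle) x) - θ x) ^ 2
      ≤ (Real.pi / 2) ^ 2 * ((C.card + 1) * (ε / K)) := by
        refine mul_le_mul_of_nonneg_left (h3.trans ?_) (sq_nonneg _)
        exact mul_le_mul_of_nonneg_right (by linarith) (div_pos hε hK).le
    _ = K * (ε / K) := by simp only [K]; ring
    _ = ε := mul_div_cancel₀ _ hK.ne'

/-- A group with a left-invariant mean is amenable. -/
theorem IsAmenableGroup.of_leftInvariant_mean {G : Type u} [Group G]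
    (h : ∃ m : Set G → ℝ, IsMean m ∧ ∀ (g : G) (A : Set G), m ((fun h => g * h) '' A) = m A) :
    IsAmenableGroup.{v, u} G := by
  obtain ⟨m, hm, hinv⟩ := h
  intro X _ ⟨x₀⟩
  -- The inverse turns left translation into the right action: `f (g * h)` acted on by `g` is `f h`.
  let f : G → X := fun g => MulOpposite.op g⁻¹ • x₀
  refine ⟨fun A => m (f ⁻¹' A), ⟨fun A => hm.nonneg _, fun A => hm.le_one _, hm.map_univ,
    fun A B hAB => hm.map_union _ _ (hAB.preimage f)⟩, fun g A => ?_⟩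
  change m _ = m _
  rw [← hinv g⁻¹ (f ⁻¹' A)]
  congr 1
  ext h
  have key : MulOpposite.op g • f (g * h) = f h := by
    simp only [f, ← mul_smul, ← MulOpposite.op_mul]
    simp
  constructor
  · rintro ⟨x, hx, hxh⟩
    refine ⟨g * h, ?_, by simp⟩
    rw [← key] at hxh
    rw [mem_preimage, ← smul_left_cancel _ hxh]
    exact hx
  · rintro ⟨k, hk, rfl⟩
    refine ⟨f k, hk, ?_⟩
    rw [← key]
    simp

theorem mainTheorem10 (Λ : AddSubgroup UnitAddCircle) (hfg : Λ.FG)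
    (hrank : Module.rank ℚ (ℚ ⊗[ℤ] Λ) ≤ 2) :
    IsAmenableGroup.{v, 0} (IETOver Λ) := by
  have : AddGroup.FG Λ := (AddGroup.fg_iff_addSubgroup_fg Λ).2 hfg
  refine IsAmenableGroup.of_leftInvariant_mean (exists_leftInvariant_mean_of_capacity
    (IET.subtype.comp (IETOver Λ).subtype) (IET.leftPerm.comp (IETOver Λ).subtype)
    (fun g => IET.finite_leftPerm_ne g) (fun g h x hx => ?_)
    fun S E ε hε => exists_cutoff_of_angles (hasZeroCapacity_of_rank_le_two hrank) S E hε)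
  exact Subtype.ext (IET.eq_one_of_leftPerm_eq g h hx)
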